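/- Let $p\ge 1$, $\varepsilon>0$, and let $G$ be a cumulative distribution function (cdf) on $\mathbb R$ with finite $p$-th moment. For a cdf $F$ and $t\in(0,1)$ let $F^{-1}(t)=q_t^-(F)=\inf\{x\in\mathbb R: F(x)\ge t\}$, and let $\mathcal M=\mathcal M_p(G,\varepsilon)$ be the set of all cdfs $F$ on $\mathbb R$ with finite $p$-th moment such that $$W_p(F,G)=\Big(\int_0^1|F^{-1}(t)-G^{-1}(t)|^p\,dt\Big)^{1/p}\le\varepsilon .$$ For $\Lambda:\mathbb R\to[0,1]$ and an increasing (non-strictly) function $f:\mathbb R\to[0,1]$ define, with $\inf\emptyset=\infty$ and $\sup\emptyset=-\infty$, $$q_\Lambda^-(f)=\inf\{x: f(x)\ge\Lambda(x)\},\quad q_\Lambda^+(f)=\inf\{x: f(x)>\Lambda(x)\},$$ $$\tilde q_\Lambda^-(f)=\sup\{x: f(x)<\Lambda(x)\},\quad \tilde q_\Lambda^+(f)=\sup\{x: f(x)\le\Lambda(x)\}.$$ Then for every $\alpha\in(0,1)$ the equations $$\int_\alpha^1\big(l(\alpha)-q_t^-(G)\big)_+^p\,dt=\varepsilon^p,\qquad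 \int_0^\alpha\big(q_t^-(G)-u(\alpha)\big)_+^p\,dt=\varepsilon^p$$ have unique real solutions $l(\alpha)$ and $u(\alpha)$. With $g_+^{-1}(x)=\inf\{t\in(0,1): g(t)>x\}$ ($\inf\emptyset=1$) for $g:(0,1)\to\mathbb R$, the extremal distributions of $\mathcal M$ are $$F_{\mathcal M}^-(x):=\inf_{F\in\mathcal M}F(x)=l_+^{-1}(x),\qquad F_{\mathcal M}^+(x):=\sup_{F\in\mathcal M}F(x)=u_+^{-1}(x),\qquad x\in\mathbb R,$$ and for every $\Lambda:\mathbb R\to[0,1]$ the following hold. (i) $\sup_{F\in\mathcal M}\tilde q_\Lambda^-(F)=\tilde q_\Lambda^-(F_{\mathcal M}^-)$, $\inf_{F\in\mathcal M}q_\Lambda^+(F)=q_\Lambda^+(F_{\mathcal M}^+)$, and $\inf_{F\in\mathcal M}q_\Lambda^-(F)=q_\Lambda^-(F_{\mathcal M}^+)$. (ii) If $\Lambda$ is decreasing (non-strictly), then $\sup_{F\in\mathcal M}q_\Lambda^-(F)=q_\Lambda^-(F_{\mathcal M}^-)$, $\inf_{F\in\mathcal M}\tilde q_\Lambda^+(F)=\tilde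 q_\Lambda^+(F_{\mathcal M}^+)$, $\inf_{F\in\mathcal M}\tilde q_\Lambda^-(F)=\tilde q_\Lambda^-(F_{\mathcal M}^+)$, and moreover $\sup_{F\in\mathcal M}\tilde q_\Lambda^+(F)=\sup_{F\in\mathcal M}q_\Lambda^+(F)=\tilde q_\Lambda^+(F_{\mathcal M}^-)$. -/

import Mathlib

open MeasureTheory ProbabilityTheory Set
open scoped ENNReal

noncomputable section

namespace RobustLambda

/-- The `Λ`-quantile `q_Λ⁻(f) = inf {x ∈ ℝ : f x ≥ Λ x}`, with values in `[-∞, ∞]`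
(so that `inf ∅ = ∞`). -/
def qMinus (Λ f : ℝ → ℝ) : EReal :=
  ⨅ (x : ℝ) (_ : Λ x ≤ f x), (x : EReal)

/-- The `Λ`-quantile `q_Λ⁺(f) = inf {x ∈ ℝ : f x > Λ x}`. -/
def qPlus (Λ f : ℝ → ℝ) : EReal :=
  ⨅ (x : ℝ) (_ : Λ x < f x), (x : EReal)

/-- The `Λ`-quantile `q̃_Λ⁻(f) = sup {x ∈ ℝ : f x < Λ x}` (with `sup ∅ = -∞`). -/
def qTildeMinus (Λ f : ℝ → ℝ) : EReal :=
  ⨆ (x : ℝ) (_ : f x < Λ x), (x : EReal)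

/-- The `Λ`-quantile `q̃_Λ⁺(f) = sup {x ∈ ℝ : f x ≤ Λ x}`. -/
def qTildePlus (Λ f : ℝ → ℝ) : EReal :=
  ⨆ (x : ℝ) (_ : f x ≤ Λ x), (x : EReal)

/-- The left quantile `F⁻¹(t) = q_t⁻(F) = inf {x : F x ≥ t}` of the distribution `F`, as a real
number. It is used at levels `t ∈ (0, 1)` only, where the set is nonempty and bounded below. -/
def quantile (F : ProbabilityMeasure ℝ) (t : ℝ) : ℝ :=
  sInf {x : ℝ | t ≤ cdf (F : Measure ℝ) x}

/-- The distributions on `ℝ` with a finite `p`-th moment. -/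
def momentClass (p : ℝ) : Set (ProbabilityMeasure ℝ) :=
  {F | Integrable (fun x : ℝ => |x| ^ p) (F : Measure ℝ)}

/-- The `p`-Wasserstein distance `(∫₀¹ |F⁻¹(t) - G⁻¹(t)|^p dt)^(1/p)`, in `[0, ∞]`. -/
def wassersteinDist (p : ℝ) (F G : ProbabilityMeasure ℝ) : ℝ≥0∞ :=
  (∫⁻ t in Ioo (0 : ℝ) 1, ENNReal.ofReal (|quantile F t - quantile G t| ^ p)) ^ (1 / p)

/-- The `p`-Wasserstein ball of radius `ε` around `G`. -/
def wassersteinBall (p : ℝ) (G : ProbabilityMeasure ℝ) (ε : ℝ) : Set (ProbabilityMeasure ℝ) :=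
  {F | F ∈ momentClass p ∧ wassersteinDist p F G ≤ ENNReal.ofReal ε}

/-- The lower extremal distribution `F_M⁻(x) = inf_{F ∈ M} F(x)` of a nonempty set `M`. -/
def lowerExtremal (M : Set (ProbabilityMeasure ℝ)) (x : ℝ) : ℝ :=
  sInf ((fun F : ProbabilityMeasure ℝ => cdf (F : Measure ℝ) x) '' M)

/-- The upper extremal distribution `F_M⁺(x) = sup_{F ∈ M} F(x)` of a nonempty set `M`. -/
def upperExtremal (M : Set (ProbabilityMeasure ℝ)) (x : ℝ) : ℝ :=
  sSup ((fun F : ProbabilityMeasure ℝ => cdf (F : Measure ℝ) x) '' M)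

/-- `g₊⁻¹(x) = inf {t ∈ (0, 1) : g t > x}` for `g : (0, 1) → ℝ`, with `inf ∅ = 1`; adding the
point `1` to the set implements this convention and does not change the infimum otherwise. Only
the values of `g` on `(0, 1)` matter. -/
def rightInv (g : ℝ → ℝ) (x : ℝ) : ℝ :=
  sInf (insert 1 {t : ℝ | t ∈ Ioo (0 : ℝ) 1 ∧ x < g t})

/-- The equation `∫_α^1 (y - q_t⁻(G))₊^p dt = ε^p` in the unknown `y`. -/
def SolvesL (p : ℝ) (G : ProbabilityMeasure ℝ) (ε α y : ℝ) : Prop :=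
  ∫ t in α..1, (max (y - quantile G t) 0) ^ p = ε ^ p

/-- The equation `∫_0^α (q_t⁻(G) - y)₊^p dt = ε^p` in the unknown `y`. -/
def SolvesU (p : ℝ) (G : ProbabilityMeasure ℝ) (ε α y : ℝ) : Prop :=
  ∫ t in (0 : ℝ)..α, (max (quantile G t - y) 0) ^ p = ε ^ p

end RobustLambda

end

namespace RobustLambda

/-! ### Partial moments as functions of the threshold -/

section Shortfall

variable {Ω : Type*} [MeasurableSpace Ω] {μ : Measure Ω} [IsFiniteMeasure μ] {p : ℝ} {X : Ω → ℝ}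

/-! Everything is read off at the level of quantile functions, where the Wasserstein cost is an
integral over levels in (0,1). If F(x) < α, the quantiles of F at levels above α all exceed x, so
the transport cost from G is at least the shortfall of G below the α-quantile of F on (α,1). This
forces x < l(α) (`lt_of_cdf_lt`). Dually, α ≤ F(x) forces u(α) ≤ x (`le_of_le_cdf`). Both bounds are
sharp: raising to x the quantiles above level a, or lowering to x those up to level a, costs exactly
the shortfall or the excess (`exists_mem_wassersteinBall_cdf_le`,
`exists_mem_wassersteinBall_le_cdf`).

The two sides differ in attainment. The supremum of F(x) is attained (`exists_cdf_eq_rightInv`), so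
`qMinus` and `qPlus` pass to the infimum for every Λ. The infimum is only shown to be approached at
x, which suffices for the strict inequality in `qTildeMinus`; a level at most the extremal value at
x is reached at each y < x (`exists_cdf_le_rightInv`), and decreasing Λ absorbs that move to the
left. For decreasing Λ the tilde and plain quantiles of monotone functions coincide, which gives the
remaining identities. -/

lemma memLp_shortfall (hX : MemLp X (ENNReal.ofReal p) μ) (y : ℝ) :
    MemLp (fun ω => max (y - X ω) 0) (ENNReal.ofReal p) μ :=
  (((memLp_const y).sub hX).sup (memLp_const 0) :)

lemma integrable_shortfall_rpow (hp : 1 ≤ p) (hX : MemLp X (ENNReal.ofReal p) μ) (y : ℝ) :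
    Integrable (fun ω => (max (y - X ω) 0) ^ p) μ := by
  have hp0 : 0 < p := by linarith
  have h := (memLp_shortfall hX y).integrable_norm_rpow (by simpa using hp0) ENNReal.ofReal_ne_top
  rw [ENNReal.toReal_ofReal hp0.le] at h
  refine h.congr (Filter.Eventually.of_forall fun ω => ?_)
  simp only [Real.norm_eq_abs, abs_of_nonneg (le_max_right (y - X ω) 0)]

lemma integral_shortfall_rpow_mono (hp : 1 ≤ p) (hX : MemLp X (ENNReal.ofReal p) μ) :
    Monotone fun y : ℝ => ∫ ω, (max (y - X ω) 0) ^ p ∂μ := by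
  intro y z hyz
  refine integral_mono (integrable_shortfall_rpow hp hX y) (integrable_shortfall_rpow hp hX z)
    fun ω => ?_
  exact Real.rpow_le_rpow (le_max_right _ _) (max_le_max (by linarith) le_rfl) (by linarith)

/-- Equal integrals would make the ordered integrands agree almost everywhere, but (y - X)₊ = (z -
X)₊ with y < z is possible only where both vanish. -/
lemma integral_shortfall_rpow_lt (hp : 1 ≤ p) (hX : MemLp X (ENNReal.ofReal p) μ) {y z : ℝ}
    (hyz : y < z) (hpos : 0 < ∫ ω, (max (y - X ω) 0) ^ p ∂μ) :
    ∫ ω, (max (y - X ω) 0) ^ p ∂μ < ∫ ω, (max (z - X ω) 0) ^ p ∂μ := by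
  refine lt_of_le_of_ne (integral_shortfall_rpow_mono hp hX hyz.le) fun heq => hpos.ne' ?_
  have hae := (integral_eq_iff_of_ae_le (integrable_shortfall_rpow hp hX y)
    (integrable_shortfall_rpow hp hX z) (Filter.Eventually.of_forall fun ω =>
      Real.rpow_le_rpow (le_max_right _ _) (max_le_max (by linarith) le_rfl) (by linarith))).1 heq
  refine integral_eq_zero_of_ae ?_
  filter_upwards [hae] with ω hω
  have h1 : max (y - X ω) 0 = max (z - X ω) 0 :=
    (Real.rpow_left_inj (le_max_right _ _) (le_max_right _ _) (by linarith)).1 hω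
  have h2 : max (y - X ω) 0 = 0 := by
    rcases le_total (y - X ω) 0 with h | h
    · exact max_eq_right h
    · rw [max_eq_left h, max_eq_left (by linarith)] at h1
      linarith
  simp only [h2, Pi.zero_apply]
  exact Real.zero_rpow (by linarith)

lemma continuous_integral_shortfall_rpow (hp : 1 ≤ p) (hX : MemLp X (ENNReal.ofReal p) μ) :
    Continuous fun y : ℝ => ∫ ω, (max (y - X ω) 0) ^ p ∂μ := by
  refine continuous_iff_continuousAt.2 fun y => ?_
  refine continuousAt_of_dominated (bound := fun ω => (max (y + 1 - X ω) 0) ^ p)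
    (Filter.Eventually.of_forall fun z => (integrable_shortfall_rpow hp hX z).1) ?_
    (integrable_shortfall_rpow hp hX _) (Filter.Eventually.of_forall fun ω => ?_)
  · filter_upwards [Iio_mem_nhds (lt_add_one y)] with z hz
    refine Filter.Eventually.of_forall fun ω => ?_
    rw [Real.norm_of_nonneg (Real.rpow_nonneg (le_max_right _ _) _)]
    exact Real.rpow_le_rpow (le_max_right _ _)
      (max_le_max (by linarith [mem_Iio.1 hz]) le_rfl) (by linarith)
  · exact (Continuous.rpow_const (by fun_prop) fun _ => Or.inr (by linarith)).continuousAt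

/-- Intermediate value theorem, with uniqueness from strict growth where the integral is positive.
The lower bound on X supplies a threshold at which the integral is zero. -/
lemma existsUnique_integral_shortfall_rpow_eq [NeZero μ] (hp : 1 ≤ p)
    (hX : MemLp X (ENNReal.ofReal p) μ) {y₀ : ℝ} (hbdd : ∀ᵐ ω ∂μ, y₀ ≤ X ω) {c : ℝ} (hc : 0 < c) :
    ∃! y : ℝ, ∫ ω, (max (y - X ω) 0) ^ p ∂μ = c := by
  have hlow : ∫ ω, (max (y₀ - X ω) 0) ^ p ∂μ = 0 := by
    refine integral_eq_zero_of_ae ?_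
    filter_upwards [hbdd] with ω hω
    rw [max_eq_right (by linarith), Real.zero_rpow (by linarith), Pi.zero_apply]
  have hm : 0 < μ.real univ := by simp [Measure.real, ENNReal.toReal_pos_iff, NeZero.ne μ,
    pos_iff_ne_zero, measure_lt_top]
  have hXi : Integrable X μ := hX.integrable (by simpa using hp)
  obtain ⟨y₁, hy₁⟩ : ∃ y, c ≤ ∫ ω, (max (y - X ω) 0) ^ p ∂μ := by
    -- Chosen so that y - X - 1 integrates to c; since p ≥ 1, s - 1 ≤ (s₊)^p for all real s.
    refine ⟨(c + μ.real univ + ∫ ω, X ω ∂μ) / μ.real univ, ?_⟩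
    set y := (c + μ.real univ + ∫ ω, X ω ∂μ) / μ.real univ with hy
    have h1 : ∫ ω, (y - X ω - 1) ∂μ = c := by
      rw [integral_sub (by fun_prop) (by fun_prop), integral_sub (by fun_prop) hXi]
      simp only [integral_const, smul_eq_mul, hy]
      field_simp
      ring
    rw [← h1]
    refine integral_mono (by fun_prop) (integrable_shortfall_rpow hp hX y) fun ω => ?_
    show y - X ω - 1 ≤ (max (y - X ω) 0) ^ p
    rcases le_total (y - X ω) 1 with h | h
    · have := Real.rpow_nonneg (le_max_right (y - X ω) 0) p
      linarith
    · rw [max_eq_left (by linarith)]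
      have := Real.rpow_le_rpow_of_exponent_le h hp
      rw [Real.rpow_one] at this
      linarith
  obtain ⟨y, hy⟩ := mem_range_of_exists_le_of_exists_ge
    (continuous_integral_shortfall_rpow hp hX) ⟨y₀, hlow.le.trans hc.le⟩ ⟨y₁, hy₁⟩
  refine ⟨y, hy, fun z hz => ?_⟩
  rcases lt_trichotomy z y with h | h | h
  · have := integral_shortfall_rpow_lt hp hX h (hc.trans_eq hz.symm)
    simp only at hy hz
    linarith
  · exact h
  · have := integral_shortfall_rpow_lt hp hX h (hc.trans_eq hy.symm)
    simp only at hy hz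
    linarith

end Shortfall

/-! ### Quantile functions -/

/-- Right continuity of the cdf makes the infimum attained. This Galois connection is the only
property of quantiles used afterwards. -/
lemma quantile_le_iff (F : ProbabilityMeasure ℝ) {t : ℝ} (ht : t ∈ Ioo (0 : ℝ) 1) (x : ℝ) :
    quantile F t ≤ x ↔ t ≤ cdf (F : Measure ℝ) x := by
  set S := {x : ℝ | t ≤ cdf (F : Measure ℝ) x} with hS
  have hne : S.Nonempty :=
    ((tendsto_cdf_atTop (F : Measure ℝ)).eventually_const_le ht.2).exists
  have hbdd : BddBelow S := by
    obtain ⟨b, hb⟩ := ((tendsto_cdf_atBot (F : Measure ℝ)).eventually_lt_const ht.1).exists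
    refine ⟨b, fun z hz => le_of_lt ?_⟩
    by_contra! h
    exact absurd (hz.trans (monotone_cdf _ h)) (not_le.2 hb)
  refine ⟨fun h => ?_, fun h => csInf_le hbdd h⟩
  have hright : ∀ z, x < z → t ≤ cdf (F : Measure ℝ) z := fun z hz => by
    obtain ⟨w, hw, hwz⟩ := exists_lt_of_csInf_lt hne (lt_of_le_of_lt h hz)
    exact le_trans hw (monotone_cdf _ hwz.le)
  have hcont := ((cdf (F : Measure ℝ)).right_continuous x).mono Ioi_subset_Ici_self
  exact ge_of_tendsto hcont (by
    filter_upwards [self_mem_nhdsWithin] with z hz using hright z hz)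

lemma quantile_monotoneOn (F : ProbabilityMeasure ℝ) : MonotoneOn (quantile F) (Ioo 0 1) := by
  intro s hs t ht hst
  exact (quantile_le_iff F hs _).2 (hst.trans ((quantile_le_iff F ht _).1 le_rfl))

instance isProbabilityMeasure_volume_unit :
    IsProbabilityMeasure (volume.restrict (Ioo (0 : ℝ) 1)) := ⟨by simp⟩

/-- The cdf of the law of `H` under the uniform distribution, when `K` is a right inverse of `H`
in the sense of Galois connections. -/
lemma cdf_map_eq {H K : ℝ → ℝ} (hH : AEMeasurable H (volume.restrict (Ioo (0 : ℝ) 1)))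
    (hK : ∀ z, K z ∈ Icc (0 : ℝ) 1) (hHK : ∀ t ∈ Ioo (0 : ℝ) 1, ∀ z, H t ≤ z ↔ t ≤ K z) (z : ℝ) :
    cdf ((volume.restrict (Ioo (0 : ℝ) 1)).map H) z = K z := by
  have := Measure.isProbabilityMeasure_map hH
  rw [cdf_eq_real, Measure.real, Measure.map_apply_of_aemeasurable hH measurableSet_Iic,
    Measure.restrict_apply' measurableSet_Ioo]
  have h1 : H ⁻¹' Iic z ∩ Ioo 0 1 = Iic (K z) ∩ Ioo 0 1 := by
    ext t
    simp only [mem_inter_iff, mem_preimage, mem_Iic]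
    exact and_congr_left fun ht => hHK t ht z
  have h2 : volume (Ioo 0 1 ∩ Iic (K z)) = volume (Ioc 0 1 ∩ Iic (K z)) :=
    measure_congr (ae_eq_set_inter Ioo_ae_eq_Ioc (ae_eq_refl _))
  rw [h1, inter_comm, h2, Ioc_inter_Iic,
    min_eq_right (hK z).2, Real.volume_Ioc, sub_zero, ENNReal.toReal_ofReal (hK z).1]

lemma aemeasurable_quantile (F : ProbabilityMeasure ℝ) :
    AEMeasurable (quantile F) (volume.restrict (Ioo (0 : ℝ) 1)) :=
  aemeasurable_restrict_of_monotoneOn measurableSet_Ioo (quantile_monotoneOn F)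

lemma cdf_mem_Icc (F : ProbabilityMeasure ℝ) (x : ℝ) : cdf (F : Measure ℝ) x ∈ Icc (0 : ℝ) 1 :=
  ⟨cdf_nonneg _ x, cdf_le_one _ x⟩

lemma map_quantile (F : ProbabilityMeasure ℝ) :
    (volume.restrict (Ioo (0 : ℝ) 1)).map (quantile F) = F := by
  have := Measure.isProbabilityMeasure_map (aemeasurable_quantile F)
  refine Measure.eq_of_cdf _ _ (StieltjesFunction.ext fun x => ?_)
  exact cdf_map_eq (aemeasurable_quantile F) (cdf_mem_Icc F)
    (fun t ht z => quantile_le_iff F ht z) x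

lemma mem_momentClass_iff {p : ℝ} (hp : 1 ≤ p) (F : ProbabilityMeasure ℝ) :
    F ∈ momentClass p ↔ MemLp id (ENNReal.ofReal p) (F : Measure ℝ) := by
  have hp0 : 0 < p := by linarith
  rw [← integrable_norm_rpow_iff aestronglyMeasurable_id (by simpa using hp0)
    ENNReal.ofReal_ne_top, ENNReal.toReal_ofReal hp0.le]
  rfl

lemma memLp_quantile {p : ℝ} (hp : 1 ≤ p) {F : ProbabilityMeasure ℝ} (hF : F ∈ momentClass p) :
    MemLp (quantile F) (ENNReal.ofReal p) (volume.restrict (Ioo (0 : ℝ) 1)) := by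
  have h := (mem_momentClass_iff hp F).1 hF
  rw [← map_quantile F, memLp_map_measure_iff aestronglyMeasurable_id (aemeasurable_quantile F)]
    at h
  exact h

lemma memLp_quantile_Ioc {p : ℝ} (hp : 1 ≤ p) {F : ProbabilityMeasure ℝ} (hF : F ∈ momentClass p)
    {a b : ℝ} (ha : 0 ≤ a) (hb : b ≤ 1) :
    MemLp (quantile F) (ENNReal.ofReal p) (volume.restrict (Ioc a b)) := by
  have h := memLp_quantile hp hF
  rw [Measure.restrict_congr_set Ioo_ae_eq_Ioc] at h
  exact h.mono_measure (Measure.restrict_mono (Ioc_subset_Ioc ha hb) le_rfl)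

/-- A distribution with prescribed quantile function `H`. -/
lemma exists_quantile_eq {p : ℝ} (hp : 1 ≤ p) {H K : ℝ → ℝ}
    (hH : MemLp H (ENNReal.ofReal p) (volume.restrict (Ioo (0 : ℝ) 1)))
    (hK : ∀ z, K z ∈ Icc (0 : ℝ) 1) (hHK : ∀ t ∈ Ioo (0 : ℝ) 1, ∀ z, H t ≤ z ↔ t ≤ K z) :
    ∃ F ∈ momentClass p, (∀ z, cdf (F : Measure ℝ) z = K z) ∧
      ∀ t ∈ Ioo (0 : ℝ) 1, quantile F t = H t := by
  have hm : AEMeasurable H (volume.restrict (Ioo (0 : ℝ) 1)) := hH.1.aemeasurable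
  let F : ProbabilityMeasure ℝ := ⟨_, Measure.isProbabilityMeasure_map hm⟩
  have hcdf : ∀ z, cdf (F : Measure ℝ) z = K z := cdf_map_eq hm hK hHK
  refine ⟨F, ?_, hcdf, fun t ht => ?_⟩
  · rw [mem_momentClass_iff hp]
    exact (memLp_map_measure_iff aestronglyMeasurable_id hm).2 hH
  · refine eq_of_forall_ge_iff fun z => ?_
    rw [quantile_le_iff F ht, hcdf, hHK t ht]

section Ball

variable {p ε : ℝ} {G : ProbabilityMeasure ℝ}

/-! ### The defining equations -/

lemma volume_restrict_Ioc_neZero {a b : ℝ} (h : a < b) : NeZero (volume.restrict (Ioc a b)) :=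
  ⟨by simpa [Measure.restrict_eq_zero] using h⟩

lemma solvesL_iff {α : ℝ} (hα : α ∈ Ioo (0 : ℝ) 1) (y : ℝ) :
    SolvesL p G ε α y ↔ ∫ t in Ioc α 1, (max (y - quantile G t) 0) ^ p = ε ^ p := by
  rw [SolvesL, intervalIntegral.integral_of_le hα.2.le]

/-- Reflection turns the excess of G over y into the shortfall of -G below -y, so the partial moment
lemmas serve both equations. -/
lemma solvesU_iff {α : ℝ} (hα : α ∈ Ioo (0 : ℝ) 1) (y : ℝ) :
    SolvesU p G ε α y ↔ ∫ t in Ioc 0 α, (max (-y - -quantile G t) 0) ^ p = ε ^ p := by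
  rw [SolvesU, intervalIntegral.integral_of_le hα.1.le]
  simp only [neg_sub_neg]

lemma existsUnique_solvesL (hp : 1 ≤ p) (hε : 0 < ε) (hG : G ∈ momentClass p) {α : ℝ}
    (hα : α ∈ Ioo (0 : ℝ) 1) : ∃! y : ℝ, SolvesL p G ε α y := by
  simp only [solvesL_iff hα]
  have := volume_restrict_Ioc_neZero hα.2
  refine existsUnique_integral_shortfall_rpow_eq hp (memLp_quantile_Ioc hp hG hα.1.le le_rfl)
    (y₀ := quantile G α) ?_ (Real.rpow_pos_of_pos hε p)
  rw [← Measure.restrict_congr_set Ioo_ae_eq_Ioc]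
  filter_upwards [ae_restrict_mem measurableSet_Ioo] with t ht
  exact quantile_monotoneOn G hα ⟨hα.1.trans ht.1, ht.2⟩ ht.1.le

lemma existsUnique_solvesU (hp : 1 ≤ p) (hε : 0 < ε) (hG : G ∈ momentClass p) {α : ℝ}
    (hα : α ∈ Ioo (0 : ℝ) 1) : ∃! y : ℝ, SolvesU p G ε α y := by
  simp only [solvesU_iff hα]
  have := volume_restrict_Ioc_neZero hα.1
  obtain ⟨y, hy, huniq⟩ := existsUnique_integral_shortfall_rpow_eq hp
    (memLp_quantile_Ioc hp hG le_rfl hα.2.le).neg (y₀ := -quantile G α) (by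
      filter_upwards [ae_restrict_mem measurableSet_Ioc] with t ht
      exact neg_le_neg (quantile_monotoneOn G ⟨ht.1, ht.2.trans_lt hα.2⟩ hα ht.2))
    (Real.rpow_pos_of_pos hε p)
  refine ⟨-y, by simpa using hy, fun z hz => ?_⟩
  rw [← huniq (-z) (by simpa using hz), neg_neg]

/-- If the shortfall of `G` below `y` over `(α, 1)` is at most `ε ^ p`, then `y` is at most the
solution of the equation for `l`. -/
lemma SolvesL.le_of_shortfall_le (hp : 1 ≤ p) (hε : 0 < ε) (hG : G ∈ momentClass p) {α y z : ℝ}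
    (hα : α ∈ Ioo (0 : ℝ) 1) (hz : SolvesL p G ε α z)
    (hy : ∫ t in Ioc α 1, (max (y - quantile G t) 0) ^ p ≤ ε ^ p) : y ≤ z := by
  rw [solvesL_iff hα] at hz
  by_contra! h
  have := integral_shortfall_rpow_lt hp (memLp_quantile_Ioc hp hG hα.1.le le_rfl) h
    (hz ▸ Real.rpow_pos_of_pos hε p)
  linarith

lemma SolvesU.le_of_excess_le (hp : 1 ≤ p) (hε : 0 < ε) (hG : G ∈ momentClass p) {α y z : ℝ}
    (hα : α ∈ Ioo (0 : ℝ) 1) (hz : SolvesU p G ε α z)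
    (hy : ∫ t in Ioc 0 α, (max (quantile G t - y) 0) ^ p ≤ ε ^ p) : z ≤ y := by
  rw [solvesU_iff hα] at hz
  by_contra! h
  have := integral_shortfall_rpow_lt hp (memLp_quantile_Ioc hp hG le_rfl hα.2.le).neg
    (neg_lt_neg h) (lt_of_lt_of_eq (Real.rpow_pos_of_pos hε p) hz.symm)
  simp only [Pi.neg_apply, neg_sub_neg] at this hz
  linarith

lemma SolvesL.shortfall_le (hp : 1 ≤ p) (hG : G ∈ momentClass p) {α y z : ℝ}
    (hα : α ∈ Ioo (0 : ℝ) 1) (hz : SolvesL p G ε α z) (hy : y ≤ z) :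
    ∫ t in α..1, (max (y - quantile G t) 0) ^ p ≤ ε ^ p := by
  rw [intervalIntegral.integral_of_le hα.2.le, ← (solvesL_iff hα z).1 hz]
  exact integral_shortfall_rpow_mono hp (memLp_quantile_Ioc hp hG hα.1.le le_rfl) hy

lemma SolvesU.excess_le (hp : 1 ≤ p) (hG : G ∈ momentClass p) {α y z : ℝ}
    (hα : α ∈ Ioo (0 : ℝ) 1) (hz : SolvesU p G ε α z) (hy : z ≤ y) :
    ∫ t in (0 : ℝ)..α, (max (quantile G t - y) 0) ^ p ≤ ε ^ p := by
  rw [intervalIntegral.integral_of_le hα.1.le, ← (solvesU_iff hα z).1 hz]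
  have := integral_shortfall_rpow_mono hp (memLp_quantile_Ioc hp hG le_rfl hα.2.le).neg
    (neg_le_neg hy)
  simpa only [Pi.neg_apply, neg_sub_neg] using this

lemma integrableOn_shortfall (hp : 1 ≤ p) (hG : G ∈ momentClass p) (y : ℝ) :
    IntegrableOn (fun t => (max (y - quantile G t) 0) ^ p) (Icc 0 1) := by
  rw [integrableOn_Icc_iff_integrableOn_Ioc]
  exact integrable_shortfall_rpow hp (memLp_quantile_Ioc hp hG le_rfl le_rfl) y

lemma integrableOn_excess (hp : 1 ≤ p) (hG : G ∈ momentClass p) (y : ℝ) :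
    IntegrableOn (fun t => (max (quantile G t - y) 0) ^ p) (Icc 0 1) := by
  rw [integrableOn_Icc_iff_integrableOn_Ioc]
  have := integrable_shortfall_rpow hp (memLp_quantile_Ioc hp hG le_rfl le_rfl).neg (-y)
  simp only [Pi.neg_apply, neg_sub_neg] at this
  exact this

/-! ### Wasserstein balls -/

lemma wassersteinDist_le_iff (hp : 1 ≤ p) (hε : 0 < ε) (F G : ProbabilityMeasure ℝ) :
    wassersteinDist p F G ≤ ENNReal.ofReal ε ↔
      ∫⁻ t in Ioo (0 : ℝ) 1, ENNReal.ofReal (|quantile F t - quantile G t| ^ p)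
        ≤ ENNReal.ofReal (ε ^ p) := by
  have hp0 : 0 < p := by linarith
  rw [wassersteinDist, one_div, ENNReal.rpow_inv_le_iff hp0,
    ENNReal.ofReal_rpow_of_nonneg hε.le hp0.le]

lemma self_mem_wassersteinBall (hp : 1 ≤ p) (hε : 0 < ε) (hG : G ∈ momentClass p) :
    G ∈ wassersteinBall p G ε := by
  refine ⟨hG, (wassersteinDist_le_iff hp hε G G).2 ?_⟩
  simp [Real.zero_rpow (by linarith : p ≠ 0)]

/-- A function dominated by the transport cost to `G` has integral at most `ε ^ p`. -/
lemma setIntegral_le_of_mem_wassersteinBall (hp : 1 ≤ p) (hε : 0 < ε) {F : ProbabilityMeasure ℝ}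
    (hF : F ∈ wassersteinBall p G ε) {s : Set ℝ} (hs : s ⊆ Ioo 0 1) (hsm : MeasurableSet s)
    {f : ℝ → ℝ} (hf : IntegrableOn f s) (hf0 : ∀ t, 0 ≤ f t)
    (hle : ∀ t ∈ s, f t ≤ |quantile F t - quantile G t| ^ p) : ∫ t in s, f t ≤ ε ^ p := by
  rw [← ENNReal.ofReal_le_ofReal_iff (Real.rpow_nonneg hε.le p),
    ofReal_integral_eq_lintegral_ofReal hf (Filter.Eventually.of_forall hf0)]
  refine le_trans (setLIntegral_mono_ae' hsm (Filter.Eventually.of_forall fun t ht =>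
    ENNReal.ofReal_le_ofReal (hle t ht))) ?_
  exact (lintegral_mono_set hs).trans ((wassersteinDist_le_iff hp hε F G).1 hF.2)

/-- A distribution whose quantile function is `H` lies in the ball if the transport cost is
bounded by a function that is concentrated on `s` and has integral at most `ε ^ p`. -/
lemma mem_wassersteinBall_of_setIntegral_le (hp : 1 ≤ p) (hε : 0 < ε) {F : ProbabilityMeasure ℝ}
    (hF : F ∈ momentClass p) {s : Set ℝ} (hsm : MeasurableSet s)
    {f : ℝ → ℝ} (hf : IntegrableOn f s) (hf0 : ∀ t, 0 ≤ f t) (hint : ∫ t in s, f t ≤ ε ^ p)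
    (hle : ∀ t ∈ s, |quantile F t - quantile G t| ^ p ≤ f t)
    (heq : ∀ t ∈ Ioo (0 : ℝ) 1 \ s, quantile F t = quantile G t) :
    F ∈ wassersteinBall p G ε := by
  refine ⟨hF, (wassersteinDist_le_iff hp hε F G).2 ?_⟩
  refine le_trans ?_ (ENNReal.ofReal_le_ofReal hint)
  rw [ofReal_integral_eq_lintegral_ofReal hf (Filter.Eventually.of_forall hf0),
    ← lintegral_indicator hsm]
  refine le_trans (setLIntegral_mono_ae' measurableSet_Ioo (Filter.Eventually.of_forall
    fun t ht => ?_)) (setLIntegral_le_lintegral _ _)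
  by_cases hts : t ∈ s
  · rw [indicator_of_mem hts]
    exact ENNReal.ofReal_le_ofReal (hle t hts)
  · simp [heq t ⟨ht, hts⟩, Real.zero_rpow (by linarith : p ≠ 0)]

/-- Raising the quantiles at levels above `a` to at least `x`. -/
lemma exists_mem_wassersteinBall_cdf_le (hp : 1 ≤ p) (hε : 0 < ε) (hG : G ∈ momentClass p)
    {a x : ℝ} (ha : a ∈ Ico (0 : ℝ) 1)
    (hint : ∫ t in a..1, (max (x - quantile G t) 0) ^ p ≤ ε ^ p) :
    ∃ F ∈ wassersteinBall p G ε, ∀ y < x, cdf (F : Measure ℝ) y ≤ a := by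
  classical
  have hQ := memLp_quantile hp hG
  have hs : Ioo a 1 ⊆ Ioo 0 1 := Ioo_subset_Ioo_left ha.1
  obtain ⟨F, hF, hcdf, hq⟩ := exists_quantile_eq hp
    (H := (Ioi a).piecewise (fun t => max (quantile G t) x) (quantile G))
    -- The cdf whose left inverse is `H`: capped at a to the left of x, unchanged from x on.
    (K := fun z => if z < x then min a (cdf (G : Measure ℝ) z) else cdf (G : Measure ℝ) z)
    (MemLp.piecewise measurableSet_Ioi ((hQ.sup (memLp_const x)).restrict _) (hQ.restrict _))
    (fun z => by
      have h := cdf_mem_Icc G z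
      split_ifs
      · exact ⟨le_min ha.1 h.1, (min_le_right _ _).trans h.2⟩
      · exact h)
    (fun t ht z => by
      have h := quantile_le_iff G ht z
      by_cases hta : a < t
      · rw [piecewise_eq_of_mem _ _ _ (mem_Ioi.2 hta), max_le_iff]
        split_ifs with hz
        · simp [not_le.2 hz, not_le.2 hta]
        · simp [not_lt.1 hz, h]
      · rw [piecewise_eq_of_notMem _ _ _ (by simpa using hta), h]
        split_ifs with hz
        · simp [not_lt.1 hta]
        · rfl)
  refine ⟨F, ?_, fun y hy => ?_⟩
  · rw [intervalIntegral.integral_of_le ha.2.le, integral_Ioc_eq_integral_Ioo] at hint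
    refine mem_wassersteinBall_of_setIntegral_le hp hε hF measurableSet_Ioo
      ((integrableOn_shortfall hp hG x).mono_set (hs.trans Ioo_subset_Icc_self))
      (fun t => Real.rpow_nonneg (le_max_right _ _) p) hint (fun t ht => ?_) fun t ht => ?_
    · rw [hq t (hs ht), piecewise_eq_of_mem _ _ _ (mem_Ioi.2 ht.1), ← max_sub_sub_right, sub_self,
        max_comm, abs_of_nonneg (le_max_right _ _)]
    · rw [hq t ht.1, piecewise_eq_of_notMem (Ioi a) _ _ fun h => ht.2 ⟨h, ht.1.2⟩]
  · rw [hcdf, if_pos hy]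
    exact min_le_left _ _

/-- Lowering the quantiles at levels up to `a` to at most `x`. -/
lemma exists_mem_wassersteinBall_le_cdf (hp : 1 ≤ p) (hε : 0 < ε) (hG : G ∈ momentClass p)
    {a x : ℝ} (ha : a ∈ Ioc (0 : ℝ) 1)
    (hint : ∫ t in (0 : ℝ)..a, (max (quantile G t - x) 0) ^ p ≤ ε ^ p) :
    ∃ F ∈ wassersteinBall p G ε, a ≤ cdf (F : Measure ℝ) x := by
  classical
  have hQ := memLp_quantile hp hG
  obtain ⟨F, hF, hcdf, hq⟩ := exists_quantile_eq hp
    (H := (Iic a).piecewise (fun t => min (quantile G t) x) (quantile G))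
    (K := fun z => if x ≤ z then max a (cdf (G : Measure ℝ) z) else cdf (G : Measure ℝ) z)
    (MemLp.piecewise measurableSet_Iic ((hQ.inf (memLp_const x)).restrict _) (hQ.restrict _))
    (fun z => by
      have h := cdf_mem_Icc G z
      split_ifs
      · exact ⟨h.1.trans (le_max_right _ _), max_le ha.2 h.2⟩
      · exact h)
    (fun t ht z => by
      have h := quantile_le_iff G ht z
      by_cases hta : t ≤ a
      · rw [piecewise_eq_of_mem _ _ _ (mem_Iic.2 hta), min_le_iff]
        split_ifs with hz
        · simp [hz, hta]
        · simp [hz, h]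
      · rw [piecewise_eq_of_notMem _ _ _ (by simpa using hta), h]
        split_ifs with hz
        · simp [hta]
        · rfl)
  refine ⟨F, ?_, ?_⟩
  · rw [intervalIntegral.integral_of_le ha.1.le] at hint
    have hf0 : ∀ t, 0 ≤ (max (quantile G t - x) 0) ^ p :=
      fun t => Real.rpow_nonneg (le_max_right _ _) p
    have hf := integrableOn_excess hp hG x
    -- The level a may be 1, where `quantile` carries no information, hence the intersection with
    -- (0,1).
    refine mem_wassersteinBall_of_setIntegral_le hp hε hF (s := Ioc 0 a ∩ Ioo 0 1)
      (measurableSet_Ioc.inter measurableSet_Ioo)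
      (hf.mono_set (inter_subset_right.trans Ioo_subset_Icc_self)) hf0
      (le_trans (setIntegral_mono_set
        (hf.mono_set (Ioc_subset_Icc_self.trans (Icc_subset_Icc_right ha.2)))
        (Filter.Eventually.of_forall hf0) inter_subset_left.eventuallyLE) hint)
      (fun t ht => ?_) fun t ht => ?_
    · rw [hq t ht.2, piecewise_eq_of_mem _ _ _ (mem_Iic.2 ht.1.2), abs_sub_comm, ← max_sub_sub_left,
        sub_self, max_comm, abs_of_nonneg (le_max_right _ _)]
    · rw [hq t ht.1, piecewise_eq_of_notMem (Iic a) _ _ fun h => ht.2 ⟨⟨ht.1.1, h⟩, ht.1⟩]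
  · rw [hcdf, if_pos le_rfl]
    exact le_max_left _ _

end Ball

section Extremal

variable {p ε : ℝ} {G : ProbabilityMeasure ℝ} {l u : ℝ → ℝ}

/-! ### The right inverse -/

lemma rightInv_bddBelow (g : ℝ → ℝ) (x : ℝ) :
    BddBelow (insert 1 {t : ℝ | t ∈ Ioo (0 : ℝ) 1 ∧ x < g t}) :=
  ⟨0, by rintro t (rfl | ht); exacts [zero_le_one, ht.1.1.le]⟩

lemma rightInv_le_one (g : ℝ → ℝ) (x : ℝ) : rightInv g x ≤ 1 :=
  csInf_le (rightInv_bddBelow g x) (mem_insert _ _)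

lemma rightInv_le {g : ℝ → ℝ} {x t : ℝ} (ht : t ∈ Ioo (0 : ℝ) 1) (hx : x < g t) :
    rightInv g x ≤ t :=
  csInf_le (rightInv_bddBelow g x) (mem_insert_of_mem _ ⟨ht, hx⟩)

lemma le_rightInv {g : ℝ → ℝ} {x c : ℝ} (h1 : c ≤ 1) (h : ∀ t ∈ Ioo (0 : ℝ) 1, x < g t → c ≤ t) :
    c ≤ rightInv g x :=
  le_csInf (insert_nonempty _ _) (by rintro t (rfl | ht); exacts [h1, h t ht.1 ht.2])

lemma exists_lt_of_rightInv_lt {g : ℝ → ℝ} {x b : ℝ} (hb : b ≤ 1) (h : rightInv g x < b) :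
    ∃ t ∈ Ioo (0 : ℝ) 1, x < g t ∧ t < b := by
  obtain ⟨t, rfl | ht, htb⟩ := exists_lt_of_csInf_lt (insert_nonempty _ _) h
  · exact absurd htb (not_lt.2 hb)
  · exact ⟨t, ht.1, ht.2, htb⟩

lemma rightInv_nonneg (g : ℝ → ℝ) (x : ℝ) : 0 ≤ rightInv g x :=
  le_rightInv zero_le_one fun _ ht _ => ht.1.le

lemma rightInv_monotone (g : ℝ → ℝ) : Monotone (rightInv g) := fun x _ hxy =>
  le_rightInv (rightInv_le_one g x) fun _ ht h => rightInv_le ht (hxy.trans_lt h)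

/-! ### The lower extremal distribution -/

lemma lt_of_cdf_lt (hp : 1 ≤ p) (hε : 0 < ε) (hG : G ∈ momentClass p)
    {F : ProbabilityMeasure ℝ} (hF : F ∈ wassersteinBall p G ε) {α x z : ℝ}
    (hα : α ∈ Ioo (0 : ℝ) 1) (hz : SolvesL p G ε α z) (hx : cdf (F : Measure ℝ) x < α) :
    x < z := by
  have hq : x < quantile F α := by
    rw [← not_le, quantile_le_iff F hα, not_le]
    exact hx
  refine hq.trans_le (hz.le_of_shortfall_le hp hε hG hα ?_)
  have hs : Ioo α 1 ⊆ Ioo 0 1 := Ioo_subset_Ioo_left hα.1.le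
  rw [integral_Ioc_eq_integral_Ioo]
  refine setIntegral_le_of_mem_wassersteinBall hp hε hF hs measurableSet_Ioo
    ((integrableOn_shortfall hp hG _).mono_set (hs.trans Ioo_subset_Icc_self))
    (fun t => Real.rpow_nonneg (le_max_right _ _) p) fun t ht => ?_
  refine Real.rpow_le_rpow (le_max_right _ _) (max_le ?_ (abs_nonneg _)) (by linarith)
  have := quantile_monotoneOn F hα (hs ht) ht.1.le
  exact le_trans (by linarith) (le_abs_self _)

lemma rightInv_le_cdf (hp : 1 ≤ p) (hε : 0 < ε) (hG : G ∈ momentClass p)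
    (hl : ∀ α ∈ Ioo (0 : ℝ) 1, SolvesL p G ε α (l α))
    {F : ProbabilityMeasure ℝ} (hF : F ∈ wassersteinBall p G ε) (x : ℝ) :
    rightInv l x ≤ cdf (F : Measure ℝ) x := by
  refine le_of_forall_gt_imp_ge_of_dense fun α hα => ?_
  rcases le_or_gt 1 α with h1 | h1
  · exact (rightInv_le_one l x).trans h1
  · have hα' : α ∈ Ioo (0 : ℝ) 1 := ⟨(cdf_nonneg _ x).trans_lt hα, h1⟩
    exact rightInv_le hα' (lt_of_cdf_lt hp hε hG hF hα' (hl α hα') hα)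

lemma exists_cdf_lt_of_rightInv_lt (hp : 1 ≤ p) (hε : 0 < ε) (hG : G ∈ momentClass p)
    (hl : ∀ α ∈ Ioo (0 : ℝ) 1, SolvesL p G ε α (l α)) {x b : ℝ} (hb : b ≤ 1)
    (h : rightInv l x < b) : ∃ F ∈ wassersteinBall p G ε, cdf (F : Measure ℝ) x < b := by
  obtain ⟨α, hα, hx, hαb⟩ := exists_lt_of_rightInv_lt hb h
  obtain ⟨F, hF, hle⟩ := exists_mem_wassersteinBall_cdf_le hp hε hG ⟨hα.1.le, hα.2⟩
    ((hl α hα).shortfall_le hp hG hα le_rfl)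
  exact ⟨F, hF, (hle x hx).trans_lt hαb⟩

/-- Raising quantiles to x controls the cdf only strictly to the left of x, because the raised mass
may sit at x itself. -/
lemma exists_cdf_le_rightInv (hp : 1 ≤ p) (hε : 0 < ε) (hG : G ∈ momentClass p)
    (hl : ∀ α ∈ Ioo (0 : ℝ) 1, SolvesL p G ε α (l α)) {x y : ℝ} (hyx : y < x) :
    ∃ F ∈ wassersteinBall p G ε, cdf (F : Measure ℝ) y ≤ rightInv l x := by
  rcases (rightInv_le_one l x).eq_or_lt with h1 | h1
  · exact ⟨G, self_mem_wassersteinBall hp hε hG, h1 ▸ cdf_le_one _ _⟩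
  have h0 := rightInv_nonneg l x
  set a := rightInv l x with ha
  have hint := integrableOn_shortfall hp hG x
  have hcont := intervalIntegral.continuousOn_primitive_interval_left (μ := volume)
    (a := 0) (b := 1) (by rwa [uIcc_of_le zero_le_one])
  rw [uIcc_of_le zero_le_one] at hcont
  have hlim := (hcont a ⟨h0, h1.le⟩).mono_of_mem_nhdsWithin (Icc_mem_nhdsGT_of_mem ⟨h0, h1⟩)
  -- The level a may be 0 or fail x < l(a). Each α in (a,1) lies above some β with x < l(β), so the
  -- shortfall over (α,1) is at most ε^p; now let α decrease to a.
  obtain ⟨F, hF, hle⟩ := exists_mem_wassersteinBall_cdf_le hp hε hG ⟨h0, h1⟩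
    (le_of_tendsto hlim (by
      filter_upwards [Ioo_mem_nhdsGT h1] with α hα
      obtain ⟨β, hβ, hx, hβα⟩ := exists_lt_of_rightInv_lt hα.2.le hα.1
      refine le_trans ?_ ((hl β hβ).shortfall_le hp hG hβ hx.le)
      exact intervalIntegral.integral_mono_interval hβα.le hα.2.le le_rfl
        (Filter.Eventually.of_forall fun t => Real.rpow_nonneg (le_max_right _ _) p)
        ((intervalIntegrable_iff_integrableOn_Ioc_of_le hβ.2.le).2
          (hint.mono_set (Ioc_subset_Icc_self.trans (Icc_subset_Icc_left hβ.1.le))))))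
  exact ⟨F, hF, hle y hyx⟩

/-! ### The upper extremal distribution -/

lemma le_of_le_cdf (hp : 1 ≤ p) (hε : 0 < ε) (hG : G ∈ momentClass p)
    {F : ProbabilityMeasure ℝ} (hF : F ∈ wassersteinBall p G ε) {α x z : ℝ}
    (hα : α ∈ Ioo (0 : ℝ) 1) (hz : SolvesU p G ε α z) (hx : α ≤ cdf (F : Measure ℝ) x) :
    z ≤ x := by
  refine hz.le_of_excess_le hp hε hG hα ?_
  have hs : Ioc 0 α ⊆ Ioo 0 1 := fun t ht => ⟨ht.1, ht.2.trans_lt hα.2⟩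
  refine setIntegral_le_of_mem_wassersteinBall hp hε hF hs measurableSet_Ioc
    ((integrableOn_excess hp hG _).mono_set (hs.trans Ioo_subset_Icc_self))
    (fun t => Real.rpow_nonneg (le_max_right _ _) p) fun t ht => ?_
  refine Real.rpow_le_rpow (le_max_right _ _) (max_le ?_ (abs_nonneg _)) (by linarith)
  have := (quantile_le_iff F (hs ht) x).2 (ht.2.trans hx)
  exact le_trans (by linarith) (neg_le_abs _)

lemma cdf_le_rightInv (hp : 1 ≤ p) (hε : 0 < ε) (hG : G ∈ momentClass p)
    (hu : ∀ α ∈ Ioo (0 : ℝ) 1, SolvesU p G ε α (u α))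
    {F : ProbabilityMeasure ℝ} (hF : F ∈ wassersteinBall p G ε) (x : ℝ) :
    cdf (F : Measure ℝ) x ≤ rightInv u x := by
  refine le_rightInv (cdf_le_one _ x) fun t ht hx => ?_
  by_contra! h
  exact absurd (le_of_le_cdf hp hε hG hF ht (hu t ht) h.le) (not_le.2 hx)

lemma exists_cdf_eq_rightInv (hp : 1 ≤ p) (hε : 0 < ε) (hG : G ∈ momentClass p)
    (hu : ∀ α ∈ Ioo (0 : ℝ) 1, SolvesU p G ε α (u α)) (x : ℝ) :
    ∃ F ∈ wassersteinBall p G ε, cdf (F : Measure ℝ) x = rightInv u x := by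
  suffices h : ∃ F ∈ wassersteinBall p G ε, rightInv u x ≤ cdf (F : Measure ℝ) x by
    obtain ⟨F, hF, hle⟩ := h
    exact ⟨F, hF, (cdf_le_rightInv hp hε hG hu hF x).antisymm hle⟩
  rcases (rightInv_nonneg u x).eq_or_lt with h0 | h0
  · exact ⟨G, self_mem_wassersteinBall hp hε hG, h0 ▸ cdf_nonneg _ _⟩
  have h1 := rightInv_le_one u x
  set s := rightInv u x with hs
  have hint := integrableOn_excess hp hG x
  have hcont := intervalIntegral.continuousOn_primitive_interval (μ := volume)
    (a := 0) (b := 1) (by rwa [uIcc_of_le zero_le_one])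
  rw [uIcc_of_le zero_le_one] at hcont
  have hlim := (hcont s ⟨h0.le, h1⟩).mono_of_mem_nhdsWithin (Icc_mem_nhdsLT_of_mem ⟨h0, h1⟩)
  refine exists_mem_wassersteinBall_le_cdf hp hε hG ⟨h0, h1⟩ (le_of_tendsto hlim ?_)
  -- Levels α below the infimum satisfy u(α) ≤ x, which bounds the excess over x; let α increase to
  -- s.
  filter_upwards [Ioo_mem_nhdsLT h0] with α hα
  have hα' : α ∈ Ioo (0 : ℝ) 1 := ⟨hα.1, hα.2.trans_le h1⟩
  refine (hu α hα').excess_le hp hG hα' ?_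
  by_contra! h
  exact absurd (rightInv_le hα' h) (not_le.2 hα.2)

lemma lowerExtremal_eq (hp : 1 ≤ p) (hε : 0 < ε) (hG : G ∈ momentClass p)
    (hl : ∀ α ∈ Ioo (0 : ℝ) 1, SolvesL p G ε α (l α)) (x : ℝ) :
    lowerExtremal (wassersteinBall p G ε) x = rightInv l x := by
  have hlow : rightInv l x ∈ lowerBounds
      ((fun F : ProbabilityMeasure ℝ => cdf (F : Measure ℝ) x) '' wassersteinBall p G ε) := by
    rintro _ ⟨F, hF, rfl⟩
    exact rightInv_le_cdf hp hε hG hl hF x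
  have hne := (nonempty_of_mem (self_mem_wassersteinBall hp hε hG)).image
    fun F : ProbabilityMeasure ℝ => cdf (F : Measure ℝ) x
  refine le_antisymm (le_of_forall_gt_imp_ge_of_dense fun b hb => ?_) (le_csInf hne hlow)
  rcases le_or_gt b 1 with hb1 | hb1
  · obtain ⟨F, hF, h⟩ := exists_cdf_lt_of_rightInv_lt hp hε hG hl hb1 hb
    exact (csInf_le ⟨_, hlow⟩ ⟨F, hF, rfl⟩).trans h.le
  · exact (csInf_le ⟨_, hlow⟩ ⟨G, self_mem_wassersteinBall hp hε hG, rfl⟩).trans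
      ((cdf_le_one _ x).trans hb1.le)

lemma upperExtremal_eq (hp : 1 ≤ p) (hε : 0 < ε) (hG : G ∈ momentClass p)
    (hu : ∀ α ∈ Ioo (0 : ℝ) 1, SolvesU p G ε α (u α)) (x : ℝ) :
    upperExtremal (wassersteinBall p G ε) x = rightInv u x := by
  obtain ⟨F, hF, h⟩ := exists_cdf_eq_rightInv hp hε hG hu x
  refine IsGreatest.csSup_eq ⟨⟨F, hF, h⟩, ?_⟩
  rintro _ ⟨F, hF, rfl⟩
  exact cdf_le_rightInv hp hε hG hu hF x

end Extremal

/-! ### Lambda-quantiles -/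

/-- No monotonicity is needed: a real strictly between the two values would belong to neither of two
complementary sets. -/
lemma qMinus_le_qTildeMinus (Λ f : ℝ → ℝ) : qMinus Λ f ≤ qTildeMinus Λ f := by
  by_contra! h
  obtain ⟨y, hy, hy'⟩ := EReal.exists_between_coe_real h
  rcases lt_or_ge (f y) (Λ y) with hlt | hge
  · exact absurd (le_iSup₂ (f := fun (x : ℝ) (_ : f x < Λ x) => (x : EReal)) y hlt) (not_le.2 hy)
  · exact absurd (iInf₂_le (f := fun (x : ℝ) (_ : Λ x ≤ f x) => (x : EReal)) y hge) (not_le.2 hy')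

lemma qPlus_le_qTildePlus (Λ f : ℝ → ℝ) : qPlus Λ f ≤ qTildePlus Λ f := by
  by_contra! h
  obtain ⟨y, hy, hy'⟩ := EReal.exists_between_coe_real h
  rcases le_or_gt (f y) (Λ y) with hle | hgt
  · exact absurd (le_iSup₂ (f := fun (x : ℝ) (_ : f x ≤ Λ x) => (x : EReal)) y hle) (not_le.2 hy)
  · exact absurd (iInf₂_le (f := fun (x : ℝ) (_ : Λ x < f x) => (x : EReal)) y hgt) (not_le.2 hy')

/-- Monotonicity of f - Λ puts all of {f < Λ} to the left of {f ≥ Λ}. -/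
lemma qMinus_eq_qTildeMinus {Λ f : ℝ → ℝ} (hΛ : Antitone Λ) (hf : Monotone f) :
    qMinus Λ f = qTildeMinus Λ f := by
  refine le_antisymm (qMinus_le_qTildeMinus Λ f) ?_
  refine iSup₂_le fun x hx => le_iInf₂ fun y hy => ?_
  rw [EReal.coe_le_coe_iff]
  by_contra! h
  linarith [hΛ h.le, hf h.le]

lemma qPlus_eq_qTildePlus {Λ f : ℝ → ℝ} (hΛ : Antitone Λ) (hf : Monotone f) :
    qPlus Λ f = qTildePlus Λ f := by
  refine le_antisymm (qPlus_le_qTildePlus Λ f) ?_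
  refine iSup₂_le fun x hx => le_iInf₂ fun y hy => ?_
  rw [EReal.coe_le_coe_iff]
  by_contra! h
  linarith [hΛ h.le, hf h.le]

lemma qMinus_anti (Λ : ℝ → ℝ) : Antitone (qMinus Λ) := fun _ _ hfg =>
  le_iInf₂ fun x hx => iInf₂_le_of_le x (hx.trans (hfg x)) le_rfl

lemma qPlus_anti (Λ : ℝ → ℝ) : Antitone (qPlus Λ) := fun _ _ hfg =>
  le_iInf₂ fun x hx => iInf₂_le_of_le x (hx.trans_le (hfg x)) le_rfl

lemma qTildeMinus_anti (Λ : ℝ → ℝ) : Antitone (qTildeMinus Λ) := fun _ _ hfg =>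
  iSup₂_le fun x hx => le_iSup₂ (f := fun (x : ℝ) _ => (x : EReal)) x ((hfg x).trans_lt hx)

lemma qTildePlus_anti (Λ : ℝ → ℝ) : Antitone (qTildePlus Λ) := fun _ _ hfg =>
  iSup₂_le fun x hx => le_iSup₂ (f := fun (x : ℝ) _ => (x : EReal)) x ((hfg x).trans hx)

/-! ### Extremal Lambda-quantiles over the Wasserstein ball -/

section Robust

variable {p ε : ℝ} {G : ProbabilityMeasure ℝ} {l u Λ : ℝ → ℝ}

lemma iSup_qTildeMinus_eq (hp : 1 ≤ p) (hε : 0 < ε) (hG : G ∈ momentClass p)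
    (hl : ∀ α ∈ Ioo (0 : ℝ) 1, SolvesL p G ε α (l α)) (hΛ : ∀ x, Λ x ≤ 1) :
    ⨆ F ∈ wassersteinBall p G ε, qTildeMinus Λ (cdf (F : Measure ℝ))
      = qTildeMinus Λ (rightInv l) := by
  refine le_antisymm (iSup₂_le fun F hF => qTildeMinus_anti Λ (rightInv_le_cdf hp hε hG hl hF))
    (iSup₂_le fun x hx => ?_)
  obtain ⟨F, hF, h⟩ := exists_cdf_lt_of_rightInv_lt hp hε hG hl (hΛ x) hx
  exact le_iSup₂_of_le F hF (le_iSup₂_of_le x h le_rfl)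

lemma iSup_qTildePlus_eq (hp : 1 ≤ p) (hε : 0 < ε) (hG : G ∈ momentClass p)
    (hl : ∀ α ∈ Ioo (0 : ℝ) 1, SolvesL p G ε α (l α)) (hΛ : Antitone Λ) :
    ⨆ F ∈ wassersteinBall p G ε, qTildePlus Λ (cdf (F : Measure ℝ))
      = qTildePlus Λ (rightInv l) := by
  refine le_antisymm (iSup₂_le fun F hF => qTildePlus_anti Λ (rightInv_le_cdf hp hε hG hl hF))
    (iSup₂_le fun x hx => ?_)
  -- It suffices to reach every real y < x, where Λ y ≥ Λ x keeps the non-strict inequality.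
  refine EReal.ge_of_forall_gt_iff_ge.1 fun y hy => ?_
  rw [EReal.coe_lt_coe_iff] at hy
  obtain ⟨F, hF, h⟩ := exists_cdf_le_rightInv hp hε hG hl hy
  exact le_iSup₂_of_le F hF (le_iSup₂_of_le y (h.trans (hx.trans (hΛ hy.le))) le_rfl)

lemma iInf_qPlus_eq (hp : 1 ≤ p) (hε : 0 < ε) (hG : G ∈ momentClass p)
    (hu : ∀ α ∈ Ioo (0 : ℝ) 1, SolvesU p G ε α (u α)) :
    ⨅ F ∈ wassersteinBall p G ε, qPlus Λ (cdf (F : Measure ℝ)) = qPlus Λ (rightInv u) := by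
  refine le_antisymm (le_iInf₂ fun x hx => ?_)
    (le_iInf₂ fun F hF => qPlus_anti Λ (cdf_le_rightInv hp hε hG hu hF))
  obtain ⟨F, hF, h⟩ := exists_cdf_eq_rightInv hp hε hG hu x
  exact iInf₂_le_of_le F hF (iInf₂_le_of_le x (h ▸ hx) le_rfl)

lemma iInf_qMinus_eq (hp : 1 ≤ p) (hε : 0 < ε) (hG : G ∈ momentClass p)
    (hu : ∀ α ∈ Ioo (0 : ℝ) 1, SolvesU p G ε α (u α)) :
    ⨅ F ∈ wassersteinBall p G ε, qMinus Λ (cdf (F : Measure ℝ)) = qMinus Λ (rightInv u) := by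
  refine le_antisymm (le_iInf₂ fun x hx => ?_)
    (le_iInf₂ fun F hF => qMinus_anti Λ (cdf_le_rightInv hp hε hG hu hF))
  obtain ⟨F, hF, h⟩ := exists_cdf_eq_rightInv hp hε hG hu x
  exact iInf₂_le_of_le F hF (iInf₂_le_of_le x (h ▸ hx) le_rfl)

end Robust

end RobustLambda

theorem theorem3 (p ε : ℝ) (hp : 1 ≤ p) (hε : 0 < ε)
    (G : ProbabilityMeasure ℝ) (hG : G ∈ RobustLambda.momentClass p) :
    -- the equations defining `l` and `u` have unique solutions
    (∀ α ∈ Ioo (0 : ℝ) 1, ∃! y : ℝ, RobustLambda.SolvesL p G ε α y) ∧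
    (∀ α ∈ Ioo (0 : ℝ) 1, ∃! y : ℝ, RobustLambda.SolvesU p G ε α y) ∧
    ∀ l u : ℝ → ℝ,
      (∀ α ∈ Ioo (0 : ℝ) 1, RobustLambda.SolvesL p G ε α (l α)) →
      (∀ α ∈ Ioo (0 : ℝ) 1, RobustLambda.SolvesU p G ε α (u α)) →
      -- the extremal distributions of the ball
      (∀ x : ℝ, RobustLambda.lowerExtremal (RobustLambda.wassersteinBall p G ε) x
        = RobustLambda.rightInv l x) ∧
      (∀ x : ℝ, RobustLambda.upperExtremal (RobustLambda.wassersteinBall p G ε) x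
        = RobustLambda.rightInv u x) ∧
      ∀ Λ : ℝ → ℝ, (∀ x, Λ x ∈ Icc (0 : ℝ) 1) →
        -- (i) arbitrary `Λ`
        ((⨆ F ∈ RobustLambda.wassersteinBall p G ε,
            RobustLambda.qTildeMinus Λ (cdf (F : Measure ℝ)))
          = RobustLambda.qTildeMinus Λ (RobustLambda.rightInv l) ∧
        (⨅ F ∈ RobustLambda.wassersteinBall p G ε,
            RobustLambda.qPlus Λ (cdf (F : Measure ℝ)))
          = RobustLambda.qPlus Λ (RobustLambda.rightInv u) ∧
        (⨅ F ∈ RobustLambda.wassersteinBall p G ε,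
            RobustLambda.qMinus Λ (cdf (F : Measure ℝ)))
          = RobustLambda.qMinus Λ (RobustLambda.rightInv u)) ∧
        -- (ii) decreasing `Λ`
        (Antitone Λ →
          (⨆ F ∈ RobustLambda.wassersteinBall p G ε,
              RobustLambda.qMinus Λ (cdf (F : Measure ℝ)))
            = RobustLambda.qMinus Λ (RobustLambda.rightInv l) ∧
          (⨅ F ∈ RobustLambda.wassersteinBall p G ε,
              RobustLambda.qTildePlus Λ (cdf (F : Measure ℝ)))
            = RobustLambda.qTildePlus Λ (RobustLambda.rightInv u) ∧
          (⨅ F ∈ RobustLambda.wassersteinBall p G ε,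
              RobustLambda.qTildeMinus Λ (cdf (F : Measure ℝ)))
            = RobustLambda.qTildeMinus Λ (RobustLambda.rightInv u) ∧
          (⨆ F ∈ RobustLambda.wassersteinBall p G ε,
              RobustLambda.qTildePlus Λ (cdf (F : Measure ℝ)))
            = (⨆ F ∈ RobustLambda.wassersteinBall p G ε,
              RobustLambda.qPlus Λ (cdf (F : Measure ℝ))) ∧
          (⨆ F ∈ RobustLambda.wassersteinBall p G ε,
              RobustLambda.qPlus Λ (cdf (F : Measure ℝ)))
            = RobustLambda.qTildePlus Λ (RobustLambda.rightInv l)) := by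
  open RobustLambda in
  refine ⟨fun α hα => existsUnique_solvesL hp hε hG hα, fun α hα => existsUnique_solvesU hp hε hG hα,
    fun l u hl hu => ⟨lowerExtremal_eq hp hε hG hl, upperExtremal_eq hp hε hG hu, fun Λ hΛ =>
      ⟨⟨iSup_qTildeMinus_eq hp hε hG hl fun x => (hΛ x).2, iInf_qPlus_eq hp hε hG hu,
        iInf_qMinus_eq hp hε hG hu⟩, fun hanti => ?_⟩⟩⟩
  have hminus : ∀ F : ProbabilityMeasure ℝ, RobustLambda.qMinus Λ (cdf (F : Measure ℝ))
      = RobustLambda.qTildeMinus Λ (cdf (F : Measure ℝ)) :=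
    fun F => RobustLambda.qMinus_eq_qTildeMinus hanti (monotone_cdf _)
  have hplus : ∀ F : ProbabilityMeasure ℝ, RobustLambda.qPlus Λ (cdf (F : Measure ℝ))
      = RobustLambda.qTildePlus Λ (cdf (F : Measure ℝ)) :=
    fun F => RobustLambda.qPlus_eq_qTildePlus hanti (monotone_cdf _)
  refine ⟨?_, ?_, ?_, ?_, ?_⟩
  · simp only [hminus]
    rw [RobustLambda.qMinus_eq_qTildeMinus hanti (RobustLambda.rightInv_monotone l)]
    exact RobustLambda.iSup_qTildeMinus_eq hp hε hG hl fun x => (hΛ x).2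
  -- The infimum of the tilde quantile is not accessible directly; the plain one is, through
  -- pointwise attainment.
  · simp only [← hplus]
    rw [← RobustLambda.qPlus_eq_qTildePlus hanti (RobustLambda.rightInv_monotone u)]
    exact RobustLambda.iInf_qPlus_eq hp hε hG hu
  · simp only [← hminus]
    rw [← RobustLambda.qMinus_eq_qTildeMinus hanti (RobustLambda.rightInv_monotone u)]
    exact RobustLambda.iInf_qMinus_eq hp hε hG hu
  · simp only [hplus]
  · simp only [hplus]
    exact RobustLambda.iSup_qTildePlus_eq hp hε hG hl hanti
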